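/- Let $m,n\ge 0$, and put $\bar\imath=0$ for $1\le i\le m$ and $\bar\imath=1$ for $m<i\le m+n$. Let $\mathrm U(\mathfrak{gl}(m|n))$ be the universal enveloping algebra of the complex Lie superalgebra $\mathfrak{gl}(m|n)$ with standard basis $E_{ij}$, $1\le i,j\le m+n$, of parity $\bar\imath+\bar\jmath$, and relations $$[E_{ij},E_{kl}]=\delta_{kj}E_{il}-\delta_{il}E_{kj}(-1)^{(\bar\imath+\bar\jmath)(\bar k+\bar l)}$$ for the supercommutator. Let $\widehat E$ be the $(m+n)\times(m+n)$ matrix with entries $\widehat E_{ij}=(-1)^{\bar\jmath}E_{ij}$, and let $\widehat E^{(k)}$ be its submatrix formed by the first $k$ rows and columns. Scalars added to a matrix stand for scalar matrices. For a square matrix $X$ over a ring with $1$ that has an inverse whose $ji$-th entry is invertible, the $ij$-th quasideterminant of $X$ is $|X|_{ij}=\big((X^{-1})_{ji}\big)^{-1}$. The quantum Berezinian is the formal series in $t$ with coefficients in $\mathrm U(\mathfrak{gl}(m|n))$ $$B(t)=\sum_{\sigma\in S_m}\operatorname{sgn}\sigma\,\big(1+t\widehat E\big)_{\sigma(1),1}\cdots\big(1+t(\widehat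 E-m+1)\big)_{\sigma(m),m}\;\times\sum_{\tau\in S_n}\operatorname{sgn}\tau\,\big(1+t(\widehat E-m+1)\big)^{-1}_{m+1,m+\tau(1)}\cdots\big(1+t(\widehat E-m+n)\big)^{-1}_{m+n,m+\tau(n)},$$ where the $k$-th factor in the first sum is $\big(1+t(\widehat E-k+1)\big)_{\sigma(k),k}$ and the $j$-th factor in the second sum is the $(m+j,m+\tau(j))$ entry of the inverse matrix $\big(1+t(\widehat E-m+j)\big)^{-1}$. Theorem. All inverse matrices and quasideterminants in this statement exist, and in the algebra of formal series $\mathrm U(\mathfrak{gl}(m|n))[[t]]$ one has $$B(t)=\big|1+t\widehat E^{(1)}\big|_{11}\cdots\big|1+t(\widehat E^{(m)}-m+1)\big|_{mm}\;\times\big|1+t(\widehat E^{(m+1)}-m+1)\big|^{-1}_{m+1,m+1}\cdots\big|1+t(\widehat E^{(m+n)}-m+n)\big|^{-1}_{m+n,m+n},$$ where the $k$-th of the first $m$ factors is $\big|1+t(\widehat E^{(k)}-k+1)\big|_{kk}$ and the $j$-th of the last $n$ factors is $\big|1+t(\widehat E^{(m+j)}-m+j)\big|^{-1}_{m+j,m+j}$.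 Moreover, these $m+n$ factors commute pairwise. -/

import Mathlib

open scoped PowerSeries

noncomputable section

namespace Glmn

/-! ### The Lie superalgebra `gl(m|n)` and its universal enveloping algebra -/

/-- The parity of an index: the first `m` indices are even, the last `n` are odd. -/
def parity (m n : ℕ) (i : Fin (m + n)) : ZMod 2 := if (i : ℕ) < m then 0 else 1

/-- The sign `(-1)^a` of `a ∈ ℤ/2`. -/
def sign (a : ZMod 2) : ℂ := (-1) ^ a.val

/-- The underlying vector space of `gl(m|n)`: complex `(m+n) × (m+n)` matrices. -/
abbrev Gl (m n : ℕ) : Type := Matrix (Fin (m + n)) (Fin (m + n)) ℂ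

/-- `x ∈ gl(m|n)` is homogeneous of degree `a`: it is a combination of matrix units whose row and
column parities add up to `a`. -/
def IsHomogeneous {m n : ℕ} (a : ZMod 2) (x : Gl m n) : Prop :=
  ∀ i j, x i j ≠ 0 → parity m n i + parity m n j = a

/-- The bracket `[x, y] = x y - (-1)^(a b) y x` of `x` of degree `a` and `y` of degree `b`. -/
def superBracket {m n : ℕ} (a b : ZMod 2) (x y : Gl m n) : Gl m n :=
  x * y - sign (a * b) • (y * x)

/-- The defining relations `x y - (-1)^(a b) y x = [x, y]` (for homogeneous `x`, `y` of degrees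
`a`, `b`) of the universal enveloping algebra, inside the tensor algebra. -/
inductive Rel (m n : ℕ) : TensorAlgebra ℂ (Gl m n) → TensorAlgebra ℂ (Gl m n) → Prop
  | bracket (a b : ZMod 2) (x y : Gl m n) (hx : IsHomogeneous a x) (hy : IsHomogeneous b y) :
      Rel m n
        (TensorAlgebra.ι ℂ x * TensorAlgebra.ι ℂ y
          - sign (a * b) • (TensorAlgebra.ι ℂ y * TensorAlgebra.ι ℂ x))
        (TensorAlgebra.ι ℂ (superBracket a b x y))

/-- The universal enveloping algebra `U(gl(m|n))`. -/
abbrev U (m n : ℕ) : Type := RingQuot (Rel m n)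

/-- The canonical linear map `gl(m|n) → U(gl(m|n))`. -/
def toU (m n : ℕ) : Gl m n →ₗ[ℂ] U m n :=
  (RingQuot.mkAlgHom ℂ (Rel m n)).toLinearMap ∘ₗ TensorAlgebra.ι ℂ

/-- The generator `E_{ij}` of `U(gl(m|n))`. -/
def E (m n : ℕ) (i j : Fin (m + n)) : U m n := toU m n (Matrix.single i j 1)

/-- The commutation relations between the generators `E_{ij}`. -/
theorem E_commrel (m n : ℕ) (i j k l : Fin (m + n)) :
    E m n i j * E m n k l
      - sign ((parity m n i + parity m n j) * (parity m n k + parity m n l)) •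
          (E m n k l * E m n i j)
      = (if k = j then E m n i l else 0)
        - (if i = l then
            sign ((parity m n i + parity m n j) * (parity m n k + parity m n l)) • E m n k j
          else 0) := by
  have hom : ∀ p q : Fin (m + n),
      IsHomogeneous (parity m n p + parity m n q) (Matrix.single p q (1 : ℂ) : Gl m n) := by
    intro p q a b h
    by_cases hab : p = a ∧ q = b
    · obtain ⟨rfl, rfl⟩ := hab
      rfl
    · exact absurd (Matrix.single_apply_of_ne _ _ _ _ _ hab) h
  have h := RingQuot.mkAlgHom_rel ℂ
    (Rel.bracket _ _ _ _ (hom i j) (hom k l))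
  simp only [map_sub, map_mul, map_smul] at h
  change E m n i j * E m n k l - _ • (E m n k l * E m n i j) = toU m n _ at h
  rw [h, superBracket, map_sub, map_smul]
  congr 1
  · by_cases hkj : k = j
    · subst hkj
      simp [E]
    · simp [hkj, Matrix.single_mul_single_of_ne _ _ _ _ (Ne.symm hkj)]
  · by_cases hil : i = l
    · subst hil
      simp [E]
    · simp [hil, Matrix.single_mul_single_of_ne _ _ _ _ (Ne.symm hil)]

/-- The matrix `Ê` over `U(gl(m|n))`, with entries `Ê_{ij} = (-1)^j E_{ij}`, where the exponent is
the parity of the column index. -/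
def Ehat (m n : ℕ) : Matrix (Fin (m + n)) (Fin (m + n)) (U m n) :=
  Matrix.of fun i j => sign (parity m n j) • E m n i j

/-- The submatrix of `A` on the first `k` rows and columns. -/
def leading {N : ℕ} {R : Type*} (A : Matrix (Fin N) (Fin N) R) (k : ℕ) (hk : k ≤ N) :
    Matrix (Fin k) (Fin k) R :=
  A.submatrix (Fin.castLE hk) (Fin.castLE hk)

/-! ### Formal series and quasideterminants over a noncommutative ring -/

/-- The matrix `1 + t (A + c)` of formal power series in the central variable `t`, where the
integer `c` stands for the scalar matrix. -/
def onePlus {N : ℕ} {R : Type*} [Ring R] (A : Matrix (Fin N) (Fin N) R) (c : ℤ) :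
    Matrix (Fin N) (Fin N) R⟦X⟧ :=
  1 + (PowerSeries.X : R⟦X⟧) • (A + (c : Matrix (Fin N) (Fin N) R)).map (PowerSeries.C (R := R))

/-- The quasideterminant `|Y|_{ij}` is defined: `Y` has a two-sided inverse, whose `ji`-th entry is
invertible. -/
def HasQuasidet {N : ℕ} {R : Type*} [Ring R] (Y : Matrix (Fin N) (Fin N) R) (i j : Fin N) : Prop :=
  IsUnit Y ∧ IsUnit (Ring.inverse Y j i)

/-- The quasideterminant `|Y|_{ij} = ((Y⁻¹)_{ji})⁻¹`, meaningful if `HasQuasidet Y i j`. Here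
`Ring.inverse` is the two-sided inverse of a unit of an arbitrary ring. -/
def quasidet {N : ℕ} {R : Type*} [Ring R] (Y : Matrix (Fin N) (Fin N) R) (i j : Fin N) : R :=
  Ring.inverse (Ring.inverse Y j i)

/-! ### The quantum Berezinian

All indices start from `0` below, so the `k`-th index, row or factor of the mathematics
is the one with value `k - 1` here. -/

/-- The matrix `1 + t (Ê - k + 1)`, for the `k`-th even index. -/
def evenMatrix (m n : ℕ) (k : Fin m) : Matrix (Fin (m + n)) (Fin (m + n)) (U m n)⟦X⟧ :=
  onePlus (Ehat m n) (-((k : ℤ) + 1) + 1)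

/-- The matrix `1 + t (Ê - m + j)`, for the `j`-th odd index. -/
def oddMatrix (m n : ℕ) (j : Fin n) : Matrix (Fin (m + n)) (Fin (m + n)) (U m n)⟦X⟧ :=
  onePlus (Ehat m n) (-(m : ℤ) + ((j : ℤ) + 1))

/-- The quantum Berezinian `B(t)`. In both sums the noncommuting factors of every product
are multiplied from left to right in increasing order of `k`, respectively `j`. -/
def berezinian (m n : ℕ) : (U m n)⟦X⟧ :=
  (∑ σ : Equiv.Perm (Fin m), ((Equiv.Perm.sign σ : ℤ) : (U m n)⟦X⟧) *
      (List.ofFn fun k : Fin m =>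
        evenMatrix m n k (Fin.castAdd n (σ k)) (Fin.castAdd n k)).prod) *
  (∑ τ : Equiv.Perm (Fin n), ((Equiv.Perm.sign τ : ℤ) : (U m n)⟦X⟧) *
      (List.ofFn fun j : Fin n =>
        Ring.inverse (oddMatrix m n j) (Fin.natAdd m j) (Fin.natAdd m (τ j))).prod)

/-- The matrix `1 + t (Ê^(k) - k + 1)` of size `k`, for the `k`-th even index. -/
def evenLeading (m n : ℕ) (k : Fin m) :
    Matrix (Fin ((k : ℕ) + 1)) (Fin ((k : ℕ) + 1)) (U m n)⟦X⟧ :=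
  onePlus (leading (Ehat m n) ((k : ℕ) + 1) (by omega)) (-((k : ℤ) + 1) + 1)

/-- The matrix `1 + t (Ê^(m+j) - m + j)` of size `m + j`, for the `j`-th odd index. -/
def oddLeading (m n : ℕ) (j : Fin n) :
    Matrix (Fin (m + (j : ℕ) + 1)) (Fin (m + (j : ℕ) + 1)) (U m n)⟦X⟧ :=
  onePlus (leading (Ehat m n) (m + (j : ℕ) + 1) (by omega)) (-(m : ℤ) + ((j : ℤ) + 1))

/-- The factor `|1 + t (Ê^(k) - k + 1)|_{kk}`. -/
def evenFactor (m n : ℕ) (k : Fin m) : (U m n)⟦X⟧ :=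
  quasidet (evenLeading m n k) (Fin.last _) (Fin.last _)

/-- The factor `|1 + t (Ê^(m+j) - m + j)|⁻¹_{m+j,m+j}`, an inverse quasideterminant. -/
def oddFactor (m n : ℕ) (j : Fin n) : (U m n)⟦X⟧ :=
  Ring.inverse (quasidet (oddLeading m n j) (Fin.last _) (Fin.last _))

end Glmn

end

/-!
# Quasideterminant factorization of the quantum Berezinian of `gl(m|n)`

Put `T_c = 1 + t (Ê + c)` and `S_c = T_c⁻¹`.

*The relations.* After multiplication by a diagonal matrix of signs, all relations between `E_{pq}`
and the entries of `Ê` say that the matrix `E_{pq} · diag(±1)`, corrected by a numerical matrix unit,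
commutes with `Ê` (`commute_twist`). It therefore commutes with `T_c`, with `S_c`, and likewise for
leading blocks. Read off entrywise, this gives the adjoint action of `E_{pq}` on `S_c`
(`commutator_of_commute_twist`) without any manipulation of super tensor signs.

*Commutation of the factors.* The factor of index `k` is, up to inversion, the last diagonal entry of
the inverse of the leading block of size `k`. By the adjoint action this entry commutes with `E_{pq}`
for `p, q < k`, at every shift `c`, hence with all factors of smaller index (`commute_corner`).

*The decomposition.* The even block of `T_{c+1}, T_c` and the transposed odd block of `S_c, S_{c+1}`
satisfy an exchange relation (`even_exchange`, `odd_exchange`), which makes the column determinant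
and the row determinant of the Berezinian alternating (`orderedDet_comp_perm`). Multiply the column
determinant on the right by the last column of the inverse of its last matrix: the result is the
determinant of size one less, so the determinant splits off the last factor
(`evenDet_succ_mul_corner`). The row determinant splits off its first factor: let `W` be
the inverse of the leading block of `T` ending at the index `k` of the first row. The row
`(W_{k1}, …, W_{kk}, 0, …, 0) T` has a single `1` at `k` and zeros before it, and its product with `S`
is `(W_{k1}, …, W_{kk}, 0, …, 0)`, so on the columns from `k` on it picks out `W_{kk}`
(`exists_row`, `oddDet_succ`).
-/

noncomputable section

namespace Glmn

/-! ### Inverses of matrices of formal series -/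

section Series

variable {N : ℕ} {R : Type*} [Ring R]

theorem onePlus_apply (A : Matrix (Fin N) (Fin N) R) (c : ℤ) (i j : Fin N) :
    onePlus A c i j = (1 : Matrix (Fin N) (Fin N) R⟦X⟧) i j
      + PowerSeries.X * PowerSeries.C (A i j + (c : Matrix (Fin N) (Fin N) R) i j) := rfl

/-- The two-sided inverse is the geometric series. -/
theorem isUnit_onePlus (A : Matrix (Fin N) (Fin N) R) (c : ℤ) : IsUnit (onePlus A c) := by
  set D := A + (c : Matrix (Fin N) (Fin N) R) with hD
  set V : Matrix (Fin N) (Fin N) R⟦X⟧ :=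
    Matrix.of fun i j => PowerSeries.mk fun d => ((-D) ^ d) i j with hV
  have key : onePlus A c = 1 + (PowerSeries.X : R⟦X⟧) • D.map (PowerSeries.C (R := R)) := rfl
  refine isUnit_iff_exists.mpr ⟨V, ?_, ?_⟩
  · rw [key]
    ext i j d
    simp only [add_mul, one_mul, Matrix.smul_mul, Matrix.add_apply, Matrix.smul_apply,
      smul_eq_mul, map_add]
    rcases d with _ | d
    · rcases eq_or_ne i j with rfl | hij <;> simp [*]
    · rw [PowerSeries.coeff_succ_X_mul]
      simp only [Matrix.mul_apply, Matrix.map_apply, map_sum, PowerSeries.coeff_C_mul]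
      simp only [hV, Matrix.of_apply, PowerSeries.coeff_mk]
      rw [← Matrix.mul_apply, pow_succ', neg_mul, Matrix.neg_apply, neg_add_cancel]
      simp [Matrix.one_apply, apply_ite, PowerSeries.coeff_one]
  · rw [key]
    ext i j d
    simp only [mul_add, mul_one, Matrix.add_apply, map_add]
    have hX : (V * (PowerSeries.X : R⟦X⟧) • D.map (PowerSeries.C (R := R))) i j
        = PowerSeries.X * (V * D.map (PowerSeries.C (R := R))) i j := by
      simp only [Matrix.mul_apply, Matrix.smul_apply, smul_eq_mul, Finset.mul_sum]
      refine Finset.sum_congr rfl fun l _ => ?_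
      rw [← mul_assoc, PowerSeries.commute_X (V i l), mul_assoc]
    rw [hX]
    rcases d with _ | d
    · rcases eq_or_ne i j with rfl | hij <;> simp [*]
    · rw [PowerSeries.coeff_succ_X_mul]
      simp only [Matrix.mul_apply, Matrix.map_apply, map_sum, PowerSeries.coeff_mul_C]
      simp only [hV, Matrix.of_apply, PowerSeries.coeff_mk]
      rw [← Matrix.mul_apply, pow_succ, mul_neg, Matrix.neg_apply, neg_add_cancel]
      simp [Matrix.one_apply, apply_ite, PowerSeries.coeff_one]

theorem constantCoeff_onePlus (A : Matrix (Fin N) (Fin N) R) (c : ℤ) :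
    (PowerSeries.constantCoeff (R := R)).mapMatrix (onePlus A c) = 1 := by
  ext i j
  rcases eq_or_ne i j with rfl | hij <;> simp [onePlus_apply, *]

/-- The diagonal entries of the inverse have constant coefficient `1`. -/
theorem isUnit_inverse_onePlus_apply (A : Matrix (Fin N) (Fin N) R) (c : ℤ) (i : Fin N) :
    IsUnit (Ring.inverse (onePlus A c) i i) := by
  rw [PowerSeries.isUnit_iff_constantCoeff]
  have h := congrArg (PowerSeries.constantCoeff (R := R)).mapMatrix
    (Ring.mul_inverse_cancel _ (isUnit_onePlus A c))
  rw [map_mul, constantCoeff_onePlus, one_mul, map_one] at h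
  have h' := congrFun (congrFun h i) i
  rw [RingHom.mapMatrix_apply, Matrix.map_apply, Matrix.one_apply_eq] at h'
  rw [h']
  exact isUnit_one

theorem hasQuasidet_onePlus (A : Matrix (Fin N) (Fin N) R) (c : ℤ) (i : Fin N) :
    HasQuasidet (onePlus A c) i i :=
  ⟨isUnit_onePlus A c, isUnit_inverse_onePlus_apply A c i⟩

theorem commute_onePlus {Z A : Matrix (Fin N) (Fin N) R} (h : Commute Z A) (c : ℤ) :
    Commute (Z.map (PowerSeries.C (R := R))) (onePlus A c) := by
  have h1 : Commute Z (A + (c : Matrix (Fin N) (Fin N) R)) := h.add_right (Int.commute_cast _ _)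
  have h2 := h1.map (PowerSeries.C (R := R)).mapMatrix
  have h4 : Commute (Z.map (PowerSeries.C (R := R)))
      ((PowerSeries.X : R⟦X⟧) • (A + (c : Matrix (Fin N) (Fin N) R)).map (PowerSeries.C (R := R))) := by
    refine Matrix.ext fun i j => ?_
    have h3 := congrFun (congrFun h2.eq i) j
    simp only [RingHom.mapMatrix_apply] at h3
    rw [Matrix.smul_mul, Matrix.smul_apply, ← h3, Matrix.mul_apply, Matrix.mul_apply, smul_eq_mul,
      Finset.mul_sum]
    refine Finset.sum_congr rfl fun l _ => ?_
    rw [Matrix.smul_apply, smul_eq_mul, ← mul_assoc, PowerSeries.commute_X, mul_assoc]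
  exact (Commute.one_right _).add_right h4

theorem commute_inverse {S : Type*} [Ring S] {a b : S} (hb : IsUnit b) (h : Commute a b) :
    Commute a (Ring.inverse b) := by
  obtain ⟨u, rfl⟩ := hb
  rw [Ring.inverse_unit]
  exact h.units_inv_right

/-- An element commuting with all entries of an invertible matrix commutes with all entries of
the inverse, since as a scalar matrix it commutes with the matrix. -/
theorem commute_inverse_apply {ι S : Type*} [Fintype ι] [DecidableEq ι] [Ring S]
    {y : S} {M : Matrix ι ι S} (hM : IsUnit M) (h : ∀ i j, Commute y (M i j)) (i j : ι) :
    Commute y (Ring.inverse M i j) := by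
  have h1 : Commute (Matrix.scalar ι y) M := by
    ext k l
    simpa using (h k l).eq
  have h2 := congrFun (congrFun (commute_inverse hM h1).eq i) j
  simpa [Commute, SemiconjBy] using h2

theorem commute_onePlus_apply {A : Matrix (Fin N) (Fin N) R} (c : ℤ) {y : R⟦X⟧} {i j : Fin N}
    (h : Commute y (PowerSeries.C (A i j))) : Commute y (onePlus A c i j) := by
  rw [onePlus_apply, map_add]
  refine Commute.add_right ?_ ((PowerSeries.commute_X y).mul_right (h.add_right ?_))
  · rw [Matrix.one_apply]
    split_ifs
    exacts [Commute.one_right _, Commute.zero_right _]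
  · rw [← Matrix.diagonal_intCast', Matrix.diagonal_apply]
    split_ifs
    · rw [show ((c : Fin N → R) i) = (c : R) from rfl, map_intCast]
      exact Int.commute_cast _ _
    · rw [map_zero]
      exact Commute.zero_right _

end Series

/-! ### The commutation relations as commuting matrices -/

theorem single_mul_apply' {ι S : Type*} [Fintype ι] [DecidableEq ι] [Ring S] (p q : ι) (x : S)
    (M : Matrix ι ι S) (k l : ι) :
    (Matrix.single p q x * M) k l = if k = p then x * M q l else 0 := by
  split_ifs with h
  · rw [h, Matrix.single_mul_apply_same]
  · rw [Matrix.single_mul_apply_of_ne _ _ _ _ _ h]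

theorem mul_single_apply' {ι S : Type*} [Fintype ι] [DecidableEq ι] [Ring S] (p q : ι) (x : S)
    (M : Matrix ι ι S) (k l : ι) :
    (M * Matrix.single p q x) k l = if l = q then M k p * x else 0 := by
  split_ifs with h
  · rw [h, Matrix.mul_single_apply_same]
  · rw [Matrix.mul_single_apply_of_ne _ _ _ _ _ h]

section Relations

variable {m n : ℕ} {R : Type*} [Ring R] [Algebra ℂ R]

theorem sign_zero : sign 0 = 1 := by simp [sign]

theorem sign_one : sign 1 = -1 := by simp [sign, ZMod.val_one]

theorem parity_cases (m n : ℕ) (i : Fin (m + n)) : parity m n i = 0 ∨ parity m n i = 1 := by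
  unfold parity
  split_ifs <;> simp

/-- The commutation relations of `gl(m|n)` in terms of the entries of `Ê`: for each `p, q`, the
matrix `A` commutes with the product of `A_{pq}` and a diagonal matrix of signs, corrected by a
numerical multiple of the matrix unit at `(q, p)`. -/
def IsGlMatrix (A : Matrix (Fin (m + n)) (Fin (m + n)) R) : Prop :=
  ∀ p q k l, sign ((parity m n p + parity m n q) * parity m n k) • (A p q * A k l)
      - (if k = q then sign (parity m n p * parity m n q) • A p l else 0) =
    sign ((parity m n p + parity m n q) * parity m n l) • (A k l * A p q)
      - (if l = p then sign (parity m n p * parity m n q) • A k q else 0)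

theorem isGlMatrix_of_commrel (x : Matrix (Fin (m + n)) (Fin (m + n)) R)
    (h : ∀ i j k l, x i j * x k l
      - sign ((parity m n i + parity m n j) * (parity m n k + parity m n l)) • (x k l * x i j)
      = (if k = j then x i l else 0)
        - (if i = l then
            sign ((parity m n i + parity m n j) * (parity m n k + parity m n l)) • x k j
          else 0)) :
    IsGlMatrix (Matrix.of fun i j => sign (parity m n j) • x i j) := by
  intro p q k l
  have hr := h p q k l
  have h11 : (1 : ZMod 2) + 1 = 0 := rfl
  simp only [@eq_comm _ p l] at hr
  rw [sub_eq_iff_eq_add] at hr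
  simp only [Matrix.of_apply, smul_mul_assoc, mul_smul_comm, hr]
  by_cases hkq : k = q <;> by_cases hlp : l = p <;>
    simp only [hkq, hlp, if_true, if_false] <;>
    rcases parity_cases m n p with hp | hp <;> rcases parity_cases m n q with hq | hq <;>
    rcases parity_cases m n k with hk | hk <;> rcases parity_cases m n l with hl | hl <;>
    simp_all [sign_zero, sign_one] <;> abel

theorem isGlMatrix_Ehat (m n : ℕ) : IsGlMatrix (Ehat m n) :=
  isGlMatrix_of_commrel (E m n) (E_commrel m n)

/-- The matrix whose commutation with `A` is the content of `IsGlMatrix`. The indices run through a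
type embedded into `{1, …, m+n}`, so as to cover submatrices of `A` too. -/
def twist {ι : Type*} [DecidableEq ι] (A : Matrix (Fin (m + n)) (Fin (m + n)) R)
    (e : ι → Fin (m + n)) (p q : ι) : Matrix ι ι R :=
  Matrix.diagonal (fun i => sign ((parity m n (e p) + parity m n (e q)) * parity m n (e i)) •
      A (e p) (e q)) -
    Matrix.single q p (sign (parity m n (e p) * parity m n (e q)) • 1)

theorem commute_twist {A : Matrix (Fin (m + n)) (Fin (m + n)) R} (hA : IsGlMatrix A)
    {ι : Type*} [Fintype ι] [DecidableEq ι] {e : ι → Fin (m + n)}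
    (he : Function.Injective e) (p q : ι) :
    Commute (twist A e p q) (A.submatrix e e) := by
  ext k l
  simpa only [twist, sub_mul, mul_sub, Matrix.sub_apply, Matrix.diagonal_mul, Matrix.mul_diagonal,
    single_mul_apply', mul_single_apply', Matrix.submatrix_apply, smul_mul_assoc, one_mul,
    mul_smul_comm, mul_one, he.eq_iff] using hA (e p) (e q) (e k) (e l)

theorem commute_twist_inverse {A : Matrix (Fin (m + n)) (Fin (m + n)) R} (hA : IsGlMatrix A)
    {N : ℕ} {e : Fin N → Fin (m + n)} (he : Function.Injective e) (p q : Fin N) (c : ℤ) :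
    Commute ((twist A e p q).map (PowerSeries.C (R := R)))
      (Ring.inverse (onePlus (A.submatrix e e) c)) :=
  commute_inverse (isUnit_onePlus _ _) (commute_onePlus (commute_twist hA he p q) c)

/-- Entries of a matrix commuting with the twists, in positions of equal row and column parity,
transform under commutation with `A_{pq}` in the adjoint representation. -/
theorem commutator_of_commute_twist {A : Matrix (Fin (m + n)) (Fin (m + n)) R}
    {ι : Type*} [Fintype ι] [DecidableEq ι] {e : ι → Fin (m + n)}
    {Y : Matrix ι ι R⟦X⟧} {p q k l : ι}
    (h : Commute ((twist A e p q).map (PowerSeries.C (R := R))) Y)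
    (hkl : parity m n (e k) = parity m n (e l)) :
    PowerSeries.C (A (e p) (e q)) * Y k l - Y k l * PowerSeries.C (A (e p) (e q)) =
      sign (parity m n (e k)) • ((if k = q then Y p l else 0) - (if l = p then Y k q else 0)) := by
  have h1 := congrFun (congrFun h.eq k) l
  have h11 : (1 : ZMod 2) + 1 = 0 := rfl
  have hmap : (twist A e p q).map (PowerSeries.C (R := R)) =
      Matrix.diagonal (fun i => sign ((parity m n (e p) + parity m n (e q)) * parity m n (e i)) •
        PowerSeries.C (A (e p) (e q))) -
      Matrix.single q p (sign (parity m n (e p) * parity m n (e q)) • (1 : R⟦X⟧)) := by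
    have hC : ∀ (a : ℂ) (x : R), PowerSeries.C (a • x) = a • PowerSeries.C x := by
      intro a x
      ext d
      rw [PowerSeries.coeff_C, PowerSeries.coeff_smul, PowerSeries.coeff_C]
      split_ifs
      exacts [rfl, (smul_zero a).symm]
    ext1 i j
    simp only [twist, Matrix.map_apply, Matrix.sub_apply, map_sub, Matrix.diagonal_apply,
      Matrix.single_apply]
    congr 1 <;> split_ifs <;> simp [hC]
  rw [hmap] at h1
  simp only [sub_mul, mul_sub, Matrix.sub_apply, Matrix.diagonal_mul, Matrix.mul_diagonal,
    single_mul_apply', mul_single_apply', smul_mul_assoc, one_mul, mul_smul_comm, mul_one] at h1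
  clear h hmap
  by_cases hkq : k = q <;> by_cases hlp : l = p <;>
    simp only [hkq, hlp, if_true, if_false] at h1 hkl ⊢ <;>
    rcases parity_cases m n (e p) with hp | hp <;> rcases parity_cases m n (e q) with hq | hq <;>
    rcases parity_cases m n (e l) with hl | hl <;>
    simp [hp, hq, hl, hkl, sign_zero, sign_one, h11] at h1 hkl ⊢ <;>
    first
      | linear_combination (norm := abel1) h1
      | linear_combination (norm := abel1) -h1

end Relations

/-! ### Ordered determinants -/

section OrderedDet

variable {R : Type*} [Ring R]

/-- The determinant `∑ sgn σ · M₀(σ 0, c 0) M₁(σ 1, c 1) ⋯` with factors multiplied in increasing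
order. The `k`-th factor has its own matrix `M k`, and `c` selects the columns. -/
def orderedDet {r : ℕ} {ι : Type*} (M : Fin r → Fin r → ι → R) (c : Fin r → ι) : R :=
  ∑ σ : Equiv.Perm (Fin r), ((Equiv.Perm.sign σ : ℤ) : R) *
    (List.ofFn fun k => M k (σ k) (c k)).prod

/-- In a product over `Fin (r + 1)`, two adjacent factors can be isolated. -/
theorem exists_prod_ofFn_eq {r : ℕ} (f : Fin (r + 1) → R) (k : Fin r) :
    ∃ a b : R, ∀ g : Fin (r + 1) → R, (∀ i, i ≠ k.castSucc → i ≠ k.succ → g i = f i) →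
      (List.ofFn g).prod = a * (g k.castSucc * g k.succ) * b := by
  induction r with
  | zero => exact k.elim0
  | succ r ih =>
    rcases Fin.eq_zero_or_eq_succ k with rfl | ⟨k, rfl⟩
    · refine ⟨1, (List.ofFn fun i : Fin r => f i.succ.succ).prod, fun g hg => ?_⟩
      have h : (fun i : Fin r => g i.succ.succ) = fun i => f i.succ.succ := by
        funext i
        refine hg _ (Fin.succ_ne_zero _) fun h => ?_
        exact Fin.succ_ne_zero _ (Fin.succ_injective _ h)
      rw [List.ofFn_succ, List.ofFn_succ, List.prod_cons, List.prod_cons, h, one_mul, mul_assoc]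
      rfl
    · obtain ⟨a, b, hab⟩ := ih (fun i => f i.succ) k
      refine ⟨f 0 * a, b, fun g hg => ?_⟩
      rw [List.ofFn_succ, List.prod_cons, hab, hg 0]
      · simp only [Fin.castSucc_succ, mul_assoc]
      · rw [Fin.castSucc_succ]
        exact (Fin.succ_ne_zero _).symm
      · exact (Fin.succ_ne_zero _).symm
      · intro i h1 h2
        refine hg _ ?_ ?_
        · rw [Fin.castSucc_succ]
          exact fun h => h1 (Fin.succ_injective _ h)
        · exact fun h => h2 (Fin.succ_injective _ h)

/-- The exchange relation between consecutive matrices: the `2 × 2` ordered minors are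
antisymmetric in the columns, as they are in the rows. -/
def IsExchange {r : ℕ} {ι : Type*} (M : Fin (r + 1) → Fin (r + 1) → ι → R) : Prop :=
  ∀ (k : Fin r) (i i' : Fin (r + 1)) (j j' : ι),
    M k.castSucc i j * M k.succ i' j' - M k.castSucc i' j * M k.succ i j'
      + M k.castSucc i j' * M k.succ i' j - M k.castSucc i' j' * M k.succ i j = 0

variable [Module ℂ R] {r : ℕ} {ι : Type*} {M : Fin (r + 1) → Fin (r + 1) → ι → R}

theorem eq_zero_of_add_self_eq_zero {x : R} (h : x + x = 0) : x = 0 := by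
  rw [← two_smul ℂ] at h
  exact (smul_eq_zero.mp h).resolve_left two_ne_zero

/-- Under the exchange relation an ordered determinant is alternating in its columns. This is the
case of two adjacent columns. -/
theorem orderedDet_comp_swap_adjacent (hM : IsExchange M) (c : Fin (r + 1) → ι) (k : Fin r) :
    orderedDet M (c ∘ Equiv.swap k.castSucc k.succ) = -orderedDet M c := by
  set s := Equiv.swap k.castSucc k.succ with hs
  have hne : k.castSucc ≠ k.succ := (Fin.castSucc_lt_succ (i := k)).ne
  -- reindexing by `σ ↦ σ s` replaces the sign by its opposite
  have reindex : ∀ d : Fin (r + 1) → ι, orderedDet M d =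
      -∑ σ : Equiv.Perm (Fin (r + 1)), ((Equiv.Perm.sign σ : ℤ) : R) *
        (List.ofFn fun i => M i ((σ * s) i) (d i)).prod := by
    intro d
    rw [orderedDet, ← Equiv.sum_comp (Equiv.mulRight s), ← Finset.sum_neg_distrib]
    refine Finset.sum_congr rfl fun σ _ => ?_
    rw [Equiv.coe_mulRight, Equiv.Perm.sign_mul, hs, Equiv.Perm.sign_swap hne]
    simp
  have h0 : ∑ σ : Equiv.Perm (Fin (r + 1)), ((Equiv.Perm.sign σ : ℤ) : R) *
      ((List.ofFn fun i => M i (σ i) (c i)).prod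
        + (List.ofFn fun i => M i (σ i) ((c ∘ s) i)).prod
        - (List.ofFn fun i => M i ((σ * s) i) (c i)).prod
        - (List.ofFn fun i => M i ((σ * s) i) ((c ∘ s) i)).prod) = 0 := by
    refine Finset.sum_eq_zero fun σ _ => ?_
    obtain ⟨a, b, hab⟩ := exists_prod_ofFn_eq (fun i => M i (σ i) (c i)) k
    have hsi : ∀ i, i ≠ k.castSucc → i ≠ k.succ → s i = i := fun i h1 h2 =>
      Equiv.swap_apply_of_ne_of_ne h1 h2
    rw [hab _ fun i _ _ => rfl,
      hab (fun i => M i (σ i) ((c ∘ s) i)) fun i h1 h2 => by simp [hsi i h1 h2],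
      hab (fun i => M i ((σ * s) i) (c i)) fun i h1 h2 => by simp [hsi i h1 h2],
      hab (fun i => M i ((σ * s) i) ((c ∘ s) i)) fun i h1 h2 => by simp [hsi i h1 h2]]
    have h := hM k (σ k.castSucc) (σ k.succ) (c k.castSucc) (c k.succ)
    simp only [Function.comp_apply, Equiv.Perm.mul_apply, hs, Equiv.swap_apply_left,
      Equiv.swap_apply_right]
    rw [← add_mul, ← mul_add, ← sub_mul, ← mul_sub, ← sub_mul, ← mul_sub]
    convert mul_zero _
    convert zero_mul _
    convert mul_zero _
    rw [← h]
    abel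
  simp only [mul_sub, mul_add, Finset.sum_sub_distrib, Finset.sum_add_distrib] at h0
  have h1 := reindex c
  have h2 := reindex (c ∘ s)
  rw [eq_neg_iff_add_eq_zero]
  refine eq_zero_of_add_self_eq_zero ?_
  change orderedDet M c + orderedDet M (c ∘ s) - _ - _ = 0 at h0
  rw [← neg_eq_iff_eq_neg] at h1 h2
  rw [← h1, ← h2] at h0
  rw [← h0]
  abel

theorem orderedDet_comp_perm (hM : IsExchange M) (c : Fin (r + 1) → ι)
    (π : Equiv.Perm (Fin (r + 1))) :
    orderedDet M (c ∘ π) = ((Equiv.Perm.sign π : ℤ) : R) * orderedDet M c := by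
  have hπ : π ∈ Submonoid.closure
      (Set.range fun i : Fin r => Equiv.swap i.castSucc i.succ) := by
    rw [Equiv.Perm.mclosure_swap_castSucc_succ]
    trivial
  induction hπ using Submonoid.closure_induction generalizing c with
  | mem x hx =>
    obtain ⟨i, rfl⟩ := hx
    rw [orderedDet_comp_swap_adjacent hM, Equiv.Perm.sign_swap (Fin.castSucc_lt_succ (i := i)).ne]
    simp
  | one => simp
  | mul x y _ _ hx hy =>
    rw [Equiv.Perm.coe_mul, ← Function.comp_assoc, hy, hx, Equiv.Perm.sign_mul, ← mul_assoc]
    congr 1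
    rw [mul_comm, Units.val_mul, Int.cast_mul]

/-- An ordered determinant with two equal columns vanishes. -/
theorem orderedDet_eq_zero (hM : IsExchange M) (c : Fin (r + 1) → ι) {i j : Fin (r + 1)}
    (hij : i ≠ j) (h : c i = c j) : orderedDet M c = 0 := by
  have h1 := orderedDet_comp_perm hM c (Equiv.swap i j)
  have h2 : c ∘ Equiv.swap i j = c := by
    funext x
    rw [Function.comp_apply, Equiv.swap_apply_def]
    split_ifs with hx hx' <;> simp_all
  rw [h2, Equiv.Perm.sign_swap hij] at h1
  refine eq_zero_of_add_self_eq_zero ?_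
  nth_rewrite 1 [h1]
  simp

end OrderedDet

section PermFixing

variable {R : Type*} [Ring R] {r : ℕ}

/-- The permutation of `Fin (r + 1)` that fixes `p` and acts on the complement as `τ`. -/
def extendPerm (p : Fin (r + 1)) (τ : Equiv.Perm (Fin r)) : Equiv.Perm (Fin (r + 1)) :=
  (finSuccEquiv' p).symm.permCongr τ.optionCongr

theorem extendPerm_self (p : Fin (r + 1)) (τ : Equiv.Perm (Fin r)) : extendPerm p τ p = p := by
  simp [extendPerm, Equiv.permCongr_apply]

theorem extendPerm_succAbove (p : Fin (r + 1)) (τ : Equiv.Perm (Fin r)) (i : Fin r) :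
    extendPerm p τ (p.succAbove i) = p.succAbove (τ i) := by
  simp [extendPerm, Equiv.permCongr_apply]

theorem sign_extendPerm (p : Fin (r + 1)) (τ : Equiv.Perm (Fin r)) :
    Equiv.Perm.sign (extendPerm p τ) = Equiv.Perm.sign τ := by
  simp [extendPerm, Equiv.optionCongr_sign]

theorem sum_perm_fixing (p : Fin (r + 1)) (f : Equiv.Perm (Fin (r + 1)) → R) :
    ∑ σ, (if σ p = p then f σ else 0) = ∑ τ, f (extendPerm p τ) := by
  rw [← Finset.sum_filter]
  refine (Finset.sum_bij (fun τ _ => extendPerm p τ) ?_ ?_ ?_ ?_).symm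
  · intro τ _
    simpa using extendPerm_self p τ
  · intro τ _ τ' _ h
    ext i
    have := congrArg (fun σ => σ (p.succAbove i)) h
    simp only [extendPerm_succAbove] at this
    exact congrArg Fin.val (Fin.succAbove_right_injective this)
  · intro σ hσ
    have hσ' : σ p = p := by simpa using hσ
    refine ⟨Equiv.removeNone ((finSuccEquiv' p).permCongr σ), Finset.mem_univ _, ?_⟩
    have h : (Equiv.removeNone ((finSuccEquiv' p).permCongr σ)).optionCongr
        = (finSuccEquiv' p).permCongr σ := by
      rw [map_equiv_removeNone]
      simp [Equiv.permCongr_apply, hσ', Equiv.Perm.one_def]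
    rw [extendPerm, h]
    ext i
    simp [Equiv.permCongr_apply]
  · intro τ _
    rfl

end PermFixing

/-! ### Expansion of ordered determinants -/

section Expansion

variable {R : Type*} [Ring R] [Module ℂ R] {r : ℕ}

/-- Multiplication by a column `x` that the last matrix maps to `w` times the last basis vector:
replacing the last column by any other gives zero, so the product is a sum over all columns, in
which only the permutations fixing the last index survive. -/
theorem orderedDet_mul_last {M : Fin (r + 1) → Fin (r + 1) → Fin (r + 1) → R}
    (hM : IsExchange M) {x : Fin (r + 1) → R} {w : R}
    (hx : ∀ i, ∑ j, M (Fin.last r) i j * x j = if i = Fin.last r then w else 0) :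
    orderedDet M id * x (Fin.last r) =
      orderedDet (fun k i j : Fin r => M k.castSucc i.castSucc j.castSucc) id * w := by
  have h1 : ∀ j, j ≠ Fin.last r → orderedDet M (Function.update id (Fin.last r) j) = 0 := by
    intro j hj
    refine orderedDet_eq_zero hM _ hj ?_
    rw [Function.update_of_ne hj, Function.update_self, id_eq]
  have h2 : ∀ j, orderedDet M (Function.update id (Fin.last r) j) =
      ∑ σ : Equiv.Perm (Fin (r + 1)), ((Equiv.Perm.sign σ : ℤ) : R) *
        ((List.ofFn fun k : Fin r => M k.castSucc (σ k.castSucc) k.castSucc).prod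
          * M (Fin.last r) (σ (Fin.last r)) j) := by
    intro j
    refine Finset.sum_congr rfl fun σ _ => ?_
    rw [List.ofFn_succ', List.concat_eq_append, List.prod_append, List.prod_singleton,
      Function.update_self]
    congr 4
    funext k
    rw [Function.update_of_ne (Fin.castSucc_lt_last k).ne, id_eq]
  calc orderedDet M id * x (Fin.last r)
      = ∑ j, orderedDet M (Function.update id (Fin.last r) j) * x j := by
        rw [Finset.sum_eq_single (Fin.last r)]
        · rw [show Function.update id (Fin.last r) (Fin.last r) = id from Function.update_eq_self _ _]
        · intro j _ hj
          rw [h1 j hj, zero_mul]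
        · exact fun h => absurd (Finset.mem_univ _) h
    _ = ∑ σ : Equiv.Perm (Fin (r + 1)), if σ (Fin.last r) = Fin.last r then
          ((Equiv.Perm.sign σ : ℤ) : R) *
            (List.ofFn fun k : Fin r => M k.castSucc (σ k.castSucc) k.castSucc).prod * w else 0 := by
        simp_rw [h2, Finset.sum_mul]
        rw [Finset.sum_comm]
        refine Finset.sum_congr rfl fun σ _ => ?_
        simp_rw [mul_assoc]
        rw [← Finset.mul_sum, ← Finset.mul_sum, hx]
        split_ifs <;> simp
    _ = _ := by
        rw [sum_perm_fixing, orderedDet, Finset.sum_mul]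
        refine Finset.sum_congr rfl fun τ _ => ?_
        rw [sign_extendPerm]
        congr 4
        funext k
        rw [← Fin.succAbove_last_apply, extendPerm_succAbove, id_eq, Fin.succAbove_last_apply,
          Fin.succAbove_last_apply]

/-- The counterpart of `orderedDet_mul_last` for the first factor. -/
theorem first_mul_orderedDet {M : Fin (r + 1) → Fin (r + 1) → Fin (r + 1) → R}
    (hM : IsExchange M) {x : Fin (r + 1) → R} {w : R}
    (hx : ∀ i, ∑ j, x j * M 0 i j = if i = 0 then w else 0) :
    x 0 * orderedDet M id = w * orderedDet (fun k i j : Fin r => M k.succ i.succ j.succ) id := by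
  have h1 : ∀ j, j ≠ 0 → orderedDet M (Function.update id 0 j) = 0 := by
    intro j hj
    refine orderedDet_eq_zero hM _ hj ?_
    rw [Function.update_of_ne hj, Function.update_self, id_eq]
  have h2 : ∀ j, orderedDet M (Function.update id 0 j) =
      ∑ σ : Equiv.Perm (Fin (r + 1)), M 0 (σ 0) j * (((Equiv.Perm.sign σ : ℤ) : R) *
        (List.ofFn fun k : Fin r => M k.succ (σ k.succ) k.succ).prod) := by
    intro j
    refine Finset.sum_congr rfl fun σ _ => ?_
    rw [List.ofFn_succ, List.prod_cons, Function.update_self, ← mul_assoc, ← mul_assoc,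
      (Int.cast_commute _ _).eq]
    simp only [Function.update_of_ne (Fin.succ_ne_zero _), id_eq]
  calc x 0 * orderedDet M id
      = ∑ j, x j * orderedDet M (Function.update id 0 j) := by
        rw [Finset.sum_eq_single 0]
        · rw [show Function.update id (0 : Fin (r + 1)) 0 = id from Function.update_eq_self _ _]
        · intro j _ hj
          rw [h1 j hj, mul_zero]
        · exact fun h => absurd (Finset.mem_univ _) h
    _ = ∑ σ : Equiv.Perm (Fin (r + 1)), if σ 0 = 0 then
          w * (((Equiv.Perm.sign σ : ℤ) : R) *
            (List.ofFn fun k : Fin r => M k.succ (σ k.succ) k.succ).prod) else 0 := by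
        simp_rw [h2, Finset.mul_sum]
        rw [Finset.sum_comm]
        refine Finset.sum_congr rfl fun σ _ => ?_
        simp_rw [← mul_assoc (x _)]
        rw [← Finset.sum_mul, hx]
        split_ifs <;> simp
    _ = _ := by
        rw [sum_perm_fixing, orderedDet, Finset.mul_sum]
        refine Finset.sum_congr rfl fun τ _ => ?_
        rw [sign_extendPerm]
        congr 4

end Expansion

/-! ### Exchange relations for the even and odd blocks -/

section Exchange

variable {m n : ℕ} {R : Type*} [Ring R]

theorem onePlus_submatrix {N K : ℕ} (A : Matrix (Fin N) (Fin N) R) {e : Fin K → Fin N}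
    (he : Function.Injective e) (c : ℤ) :
    onePlus (A.submatrix e e) c = (onePlus A c).submatrix e e := by
  have h : ((c : Matrix (Fin K) (Fin K) R)) = (c : Matrix (Fin N) (Fin N) R).submatrix e e := by
    rw [← Matrix.diagonal_intCast', ← Matrix.diagonal_intCast', Matrix.submatrix_diagonal _ _ he]
    rfl
  refine Matrix.ext fun i j => ?_
  rw [Matrix.submatrix_apply, onePlus_apply, onePlus_apply, h, ← Matrix.submatrix_one e he]
  rfl

theorem onePlus_add_one {N : ℕ} (A : Matrix (Fin N) (Fin N) R) (c : ℤ) :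
    onePlus A (c + 1) = onePlus A c + Matrix.scalar (Fin N) (PowerSeries.X : R⟦X⟧) := by
  refine Matrix.ext fun i j => ?_
  rw [Matrix.add_apply, onePlus_apply, onePlus_apply, Int.cast_add, Int.cast_one, Matrix.add_apply,
    ← add_assoc (A i j), map_add, mul_add, add_assoc]
  congr 2
  rcases eq_or_ne i j with rfl | h
  · simp
  · simp [h]

theorem commute_scalar_X {N : ℕ} (M : Matrix (Fin N) (Fin N) R⟦X⟧) :
    Commute (Matrix.scalar (Fin N) (PowerSeries.X : R⟦X⟧)) M :=
  Matrix.scalar_commute _ (fun r => (PowerSeries.commute_X r).symm) _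

/-- Up to central terms, the entries of `1 + t (A + c)` are those of `t A`. -/
theorem onePlus_apply_commutator {N : ℕ} (A : Matrix (Fin N) (Fin N) R) (c : ℤ) (i j : Fin N)
    (y : R⟦X⟧) : onePlus A c i j * y - y * onePlus A c i j =
      PowerSeries.X * (PowerSeries.C (A i j) * y - y * PowerSeries.C (A i j)) := by
  set z := onePlus A c i j - PowerSeries.X * PowerSeries.C (A i j) with hz
  have h : Commute y z := by
    have h1 := commute_onePlus_apply (A := (0 : Matrix (Fin N) (Fin N) R)) c (y := y) (i := i)
      (j := j) (by simp)
    have h2 : z = onePlus 0 c i j := by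
      rw [hz, onePlus_apply, onePlus_apply, map_add, mul_add, Matrix.zero_apply, zero_add]
      abel
    rwa [h2]
  rw [show onePlus A c i j = z + PowerSeries.X * PowerSeries.C (A i j) by rw [hz]; abel,
    add_mul, mul_add, ← h.eq, ← mul_assoc y, PowerSeries.commute_X y, mul_sub PowerSeries.X, mul_assoc, mul_assoc]
  abel

/-- The resolvent identity for shifts differing by one. -/
theorem inverse_mul_inverse_mul_scalar_X {N : ℕ} (A : Matrix (Fin N) (Fin N) R) (c : ℤ) :
    Ring.inverse (onePlus A c) * Ring.inverse (onePlus A (c + 1)) *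
        Matrix.scalar (Fin N) (PowerSeries.X : R⟦X⟧) =
      Ring.inverse (onePlus A c) - Ring.inverse (onePlus A (c + 1)) ∧
    Ring.inverse (onePlus A (c + 1)) * Ring.inverse (onePlus A c) *
        Matrix.scalar (Fin N) (PowerSeries.X : R⟦X⟧) =
      Ring.inverse (onePlus A c) - Ring.inverse (onePlus A (c + 1)) := by
  set T := onePlus A c
  set T' := onePlus A (c + 1)
  have hx : Matrix.scalar (Fin N) (PowerSeries.X : R⟦X⟧) = T' - T := by
    rw [eq_sub_iff_add_eq, add_comm]
    exact (onePlus_add_one A c).symm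
  have h1 := Ring.inverse_mul_cancel T (isUnit_onePlus A c)
  have h2 := Ring.inverse_mul_cancel T' (isUnit_onePlus A (c + 1))
  have h3 := Ring.mul_inverse_cancel T (isUnit_onePlus A c)
  have h4 := Ring.mul_inverse_cancel T' (isUnit_onePlus A (c + 1))
  constructor
  · rw [mul_assoc, ← (commute_scalar_X _).eq, hx, sub_mul, mul_sub, h4, mul_one, ← mul_assoc, h1,
      one_mul]
  · rw [mul_assoc, ← (commute_scalar_X _).eq, hx, sub_mul, mul_sub, h3, mul_one, ← mul_assoc, h2,
      one_mul]

variable [Algebra ℂ R] {A : Matrix (Fin (m + n)) (Fin (m + n)) R}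

theorem commute_twist_onePlus (hA : IsGlMatrix A) (p q : Fin (m + n)) (c : ℤ) :
    Commute ((twist A id p q).map (PowerSeries.C (R := R))) (onePlus A c) :=
  commute_onePlus (commute_twist hA Function.injective_id p q) c

/-- The exchange relation for the even-even block of `1 + t (A + c)`. -/
theorem even_exchange (hA : IsGlMatrix A) (c : ℤ) {i j k l : Fin (m + n)}
    (hj : parity m n j = 0) (hk : parity m n k = 0)
    (hl : parity m n l = 0) :
    onePlus A (c + 1) i j * onePlus A c k l - onePlus A (c + 1) k j * onePlus A c i l
      + onePlus A (c + 1) i l * onePlus A c k j - onePlus A (c + 1) k l * onePlus A c i j = 0 := by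
  have key : ∀ {j l : Fin (m + n)}, parity m n j = 0 → parity m n l = 0 →
      onePlus A (c + 1) i j * onePlus A c k l - onePlus A c k l * onePlus A (c + 1) i j =
      onePlus A (c + 1) k j * onePlus A c i l - onePlus A c k j * onePlus A (c + 1) i l := by
    intro j l hj hl
    have h := commutator_of_commute_twist (commute_twist_onePlus hA i j c) (hk.trans hl.symm)
    simp only [id_eq, hk, sign_zero, one_smul] at h
    rw [onePlus_add_one, Matrix.add_apply, add_mul, mul_add, add_sub_add_comm,
      onePlus_apply_commutator, h]
    simp only [Matrix.add_apply, Matrix.scalar_apply, Matrix.diagonal_apply, add_mul, mul_add,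
      mul_sub, mul_ite, ite_mul, mul_zero, zero_mul, (PowerSeries.commute_X _).eq, @eq_comm _ l i]
    abel
  have h1 := key hj hl
  have h2 := key hl hj
  linear_combination (norm := abel1) h1 + h2

/-- The commutation relation between entries of the odd-odd blocks of two consecutive inverse
matrices. Commutators with the entries of `1 + t (A + c)` are known from the adjoint action, and
`[S, y] = -S [T, y] S` for `S = T⁻¹` turns them into commutators with the entries of the inverse;
the quadratic terms are then reduced by the resolvent identity. -/
theorem odd_commutator (hA : IsGlMatrix A) (c : ℤ) (i j : Fin (m + n)) {k l : Fin (m + n)}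
    (hk : parity m n k = 1) (hl : parity m n l = 1) :
    Ring.inverse (onePlus A c) i j * Ring.inverse (onePlus A (c + 1)) k l
        - Ring.inverse (onePlus A (c + 1)) k l * Ring.inverse (onePlus A c) i j =
      Ring.inverse (onePlus A c) i l * Ring.inverse (onePlus A (c + 1)) k j
        - Ring.inverse (onePlus A (c + 1)) i l * Ring.inverse (onePlus A c) k j := by
  obtain ⟨hr1, hr2⟩ := inverse_mul_inverse_mul_scalar_X A c
  have hT1 := Ring.inverse_mul_cancel _ (isUnit_onePlus A c)
  have hT2 := Ring.mul_inverse_cancel _ (isUnit_onePlus A c)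
  have hS' : ∀ p q, Commute ((twist A id p q).map (PowerSeries.C (R := R)))
      (Ring.inverse (onePlus A (c + 1))) := fun p q =>
    commute_inverse (isUnit_onePlus A (c + 1)) (commute_twist_onePlus hA p q (c + 1))
  have hT : ∀ p q, onePlus A c p q * Ring.inverse (onePlus A (c + 1)) k l
      - Ring.inverse (onePlus A (c + 1)) k l * onePlus A c p q =
      PowerSeries.X * -((if k = q then Ring.inverse (onePlus A (c + 1)) p l else 0)
        - (if l = p then Ring.inverse (onePlus A (c + 1)) k q else 0)) := by
    intro p q
    have h := commutator_of_commute_twist (hS' p q) (hk.trans hl.symm)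
    simp only [id_eq, hk, sign_one, neg_one_smul] at h
    rw [onePlus_apply_commutator, h]
  generalize Ring.inverse (onePlus A c) = S at *
  generalize Ring.inverse (onePlus A (c + 1)) = S' at *
  generalize onePlus A c = T at *
  set ξ := Matrix.scalar (Fin (m + n)) (PowerSeries.X : R⟦X⟧)
  set η := Matrix.scalar (Fin (m + n)) (S' k l) with hη
  set u := Matrix.single l k (1 : R⟦X⟧) with hu
  have h1 : T * η - η * T = -((S' * u - u * S') * ξ) := by
    refine Matrix.ext fun p q => ?_
    rw [← (commute_scalar_X _).eq, ← mul_neg]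
    simp only [hη, hu, Matrix.sub_apply, Matrix.neg_apply, Matrix.scalar_apply,
      Matrix.mul_diagonal, Matrix.diagonal_mul, single_mul_apply', mul_single_apply', mul_one,
      one_mul]
    rw [hT p q]
    simp only [@eq_comm _ q k, @eq_comm _ p l]
  have h2 : η * S - S * η = -((S - S') * u * S - S * u * (S - S')) := by
    calc η * S - S * η = S * (T * η - η * T) * S := by
          rw [mul_sub, sub_mul, ← mul_assoc, hT1, one_mul, mul_assoc, mul_assoc η, hT2, mul_one]
      _ = -((S * S' * ξ) * u * S - S * u * (S' * S * ξ)) := by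
          rw [h1, ← (commute_scalar_X (S' * u - u * S')).eq, ← (commute_scalar_X (S * S')).eq,
            ← (commute_scalar_X (S' * S)).eq, mul_neg, neg_mul, ← mul_assoc S,
            ← (commute_scalar_X S).eq, ← mul_assoc (S * u), ← (commute_scalar_X (S * u)).eq]
          noncomm_ring
      _ = _ := by rw [hr1, hr2]
  have h3 := congrFun (congrFun h2 i) j
  simp only [Matrix.sub_apply, Matrix.neg_apply, hη, Matrix.scalar_apply, Matrix.mul_diagonal,
    Matrix.diagonal_mul] at h3
  have h4 : ∀ P Q : Matrix (Fin (m + n)) (Fin (m + n)) R⟦X⟧, (P * u * Q) i j = P i l * Q k j := by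
    intro P Q
    rw [hu, mul_assoc, Matrix.mul_apply, Finset.sum_eq_single l]
    · rw [single_mul_apply', if_pos rfl, one_mul]
    · intro b _ hb
      rw [single_mul_apply', if_neg hb, mul_zero]
    · exact fun h => absurd (Finset.mem_univ _) h
  rw [h4, h4, Matrix.sub_apply, Matrix.sub_apply, sub_mul, mul_sub] at h3
  linear_combination (norm := abel1) -h3

/-- The exchange relation for the transposed odd-odd block of `(1 + t (A + c))⁻¹`. -/
theorem odd_exchange (hA : IsGlMatrix A) (c : ℤ) {i j k l : Fin (m + n)}
    (hj : parity m n j = 1) (hk : parity m n k = 1)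
    (hl : parity m n l = 1) :
    Ring.inverse (onePlus A c) j i * Ring.inverse (onePlus A (c + 1)) l k
      - Ring.inverse (onePlus A c) j k * Ring.inverse (onePlus A (c + 1)) l i
      + Ring.inverse (onePlus A c) l i * Ring.inverse (onePlus A (c + 1)) j k
      - Ring.inverse (onePlus A c) l k * Ring.inverse (onePlus A (c + 1)) j i = 0 := by
  have h1 := odd_commutator hA c j i hl hk
  have h2 := odd_commutator hA c l i hj hk
  linear_combination (norm := abel1) h1 + h2

end Exchange

/-! ### Corner entries of inverses of leading blocks -/

section Corner

variable {N : ℕ} {R : Type*} [Ring R]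

/-- The last diagonal entry of the inverse of `1 + t (A^(k+1) + c)`, where `A^(k+1)` is the leading
submatrix of size `k + 1`. It is the inverse of a quasideterminant. -/
def corner (A : Matrix (Fin N) (Fin N) R) (k : ℕ) (hk : k + 1 ≤ N) (c : ℤ) : R⟦X⟧ :=
  Ring.inverse (onePlus (leading A (k + 1) hk) c) (Fin.last k) (Fin.last k)

theorem corner_congr (A : Matrix (Fin N) (Fin N) R) {k l : ℕ} (h : k = l) (hk : k + 1 ≤ N)
    (hl : l + 1 ≤ N) (c : ℤ) : corner A k hk c = corner A l hl c := by
  subst h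
  rfl

theorem isUnit_corner (A : Matrix (Fin N) (Fin N) R) (k : ℕ) (hk : k + 1 ≤ N) (c : ℤ) :
    IsUnit (corner A k hk c) :=
  isUnit_inverse_onePlus_apply _ _ _

/-- The larger corner commutes with `A_{pq}` for all `p, q ≤ k`, because neither the last row nor the
last column is moved by the adjoint action of the smaller leading block. -/
theorem commute_corner {m n : ℕ} [Algebra ℂ R] {A : Matrix (Fin (m + n)) (Fin (m + n)) R}
    (hA : IsGlMatrix A) {k l : ℕ} (hkl : k < l) (hk : k + 1 ≤ m + n) (hl : l + 1 ≤ m + n)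
    (c d : ℤ) : Commute (corner A k hk c) (corner A l hl d) := by
  refine (commute_inverse_apply (y := corner A l hl d)
    (isUnit_onePlus (leading A (k + 1) hk) c) (fun i j => ?_) _ _).symm
  refine commute_onePlus_apply c (Commute.symm ?_)
  have hne : ∀ i : Fin (k + 1), Fin.last l ≠ Fin.castLE (by omega) i := by
    intro i h
    have := congrArg Fin.val h
    simp only [Fin.val_last, Fin.val_castLE] at this
    omega
  have h := commutator_of_commute_twist (commute_twist_inverse hA (Fin.castLE_injective hl)
    (Fin.castLE (by omega) i) (Fin.castLE (by omega) j) d)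
    (k := Fin.last l) (l := Fin.last l) rfl
  rw [if_neg (hne j), if_neg (hne i), sub_zero, smul_zero, sub_eq_zero] at h
  exact h

/-- The row `ρ = (W_k, 0) T`, where `W` is the inverse of the leading block of `T` ending at the
index `k`, vanishes to the left of `k`, has entry `1` at `k`, and satisfies `ρ T⁻¹ = (W_k, 0)`. -/
theorem exists_row (A : Matrix (Fin N) (Fin N) R) (k : ℕ) (hk : k + 1 ≤ N)
    (c : ℤ) : ∃ ρ : Fin N → R⟦X⟧, (∀ i : Fin N, (i : ℕ) < k → ρ i = 0) ∧ ρ ⟨k, hk⟩ = 1 ∧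
      ∀ l : Fin N, k ≤ l → ∑ i, ρ i * Ring.inverse (onePlus A c) i l =
        if (l : ℕ) = k then corner A k hk c else 0 := by
  set W := Ring.inverse (onePlus (leading A (k + 1) hk) c) with hW
  set S := Ring.inverse (onePlus A c) with hS
  have hcol : ∀ i : Fin (k + 1), ∑ p : Fin (k + 1), W (Fin.last k) p *
      onePlus A c (Fin.castLE hk p) (Fin.castLE hk i) = if Fin.last k = i then 1 else 0 := by
    intro i
    have h := Matrix.ext_iff.mpr (Ring.inverse_mul_cancel _
      (isUnit_onePlus (leading A (k + 1) hk) c)) (Fin.last k) i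
    rw [Matrix.mul_apply, Matrix.one_apply] at h
    rw [← h]
    refine Finset.sum_congr rfl fun p _ => ?_
    rw [hW, leading, onePlus_submatrix A (Fin.castLE_injective hk)]
    rfl
  refine ⟨fun i => ∑ p : Fin (k + 1), W (Fin.last k) p * onePlus A c (Fin.castLE hk p) i,
    fun i hi => ?_, ?_, fun l hl => ?_⟩
  · have h := hcol ⟨i, by omega⟩
    rw [if_neg (by intro h; have := congrArg Fin.val h; simp at this; omega)] at h
    exact h
  · have h := hcol (Fin.last k)
    rw [if_pos rfl] at h
    exact h
  · simp_rw [Finset.sum_mul]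
    rw [Finset.sum_comm]
    have hTS : ∀ p : Fin (k + 1), ∑ i, W (Fin.last k) p * onePlus A c (Fin.castLE hk p) i * S i l =
        if Fin.castLE hk p = l then W (Fin.last k) p else 0 := by
      intro p
      have h := Matrix.ext_iff.mpr (Ring.mul_inverse_cancel _ (isUnit_onePlus A c))
        (Fin.castLE hk p) l
      rw [Matrix.mul_apply, Matrix.one_apply] at h
      simp_rw [mul_assoc]
      rw [← Finset.mul_sum, h, mul_ite, mul_one, mul_zero]
    simp_rw [hTS]
    split_ifs with hlk
    · rw [Finset.sum_eq_single (Fin.last k)]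
      · rw [if_pos (Fin.ext hlk.symm)]
        rfl
      · intro p _ hp
        refine if_neg fun h => hp (Fin.ext ?_)
        rw [← Fin.val_castLE hk p, h, hlk, Fin.val_last]
      · exact fun h => absurd (Finset.mem_univ _) h
    · refine Finset.sum_eq_zero fun p _ => if_neg fun h => hlk ?_
      have h1 := congrArg Fin.val h
      rw [Fin.val_castLE] at h1
      omega

end Corner

/-! ### Factorization of the shifted determinants -/

section Decomposition

variable {m n : ℕ} {R : Type*} [Ring R] [Algebra ℂ R]
  {A : Matrix (Fin (m + n)) (Fin (m + n)) R}

theorem parity_of_lt {i : Fin (m + n)} (h : (i : ℕ) < m) : parity m n i = 0 := if_pos h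

theorem parity_of_le {i : Fin (m + n)} (h : m ≤ (i : ℕ)) : parity m n i = 1 := if_neg h.not_gt

/-- The shifted column determinant of the leading even block of size `k`. -/
def evenDet (A : Matrix (Fin (m + n)) (Fin (m + n)) R) (k : ℕ) (hk : k ≤ m) : R⟦X⟧ :=
  orderedDet (fun r i j : Fin k => onePlus A (-((r : ℤ) + 1) + 1)
    ⟨i, by omega⟩ ⟨j, by omega⟩) id

theorem evenDet_succ_mul_corner (hA : IsGlMatrix A) (k : ℕ) (hk : k + 1 ≤ m) :
    evenDet A (k + 1) hk * corner A k (by omega) (-((k : ℤ) + 1) + 1) =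
      evenDet A k (by omega) := by
  set c : ℤ := -((k : ℤ) + 1) + 1 with hc
  have hle : k + 1 ≤ m + n := by omega
  have h := orderedDet_mul_last (M := fun r i j : Fin (k + 1) => onePlus A (-((r : ℤ) + 1) + 1)
    ⟨i, by omega⟩ ⟨j, by omega⟩) ?_
    (x := fun j => Ring.inverse (onePlus (leading A (k + 1) hle) c) j (Fin.last k)) (w := 1) ?_
  · rw [mul_one] at h
    exact h
  · intro r i i' j j'
    have h := even_exchange hA (-((r : ℤ) + 1)) (i := ⟨i, by omega⟩) (j := ⟨j, by omega⟩)
      (k := ⟨i', by omega⟩) (l := ⟨j', by omega⟩)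
      (parity_of_lt (by simp only; omega)) (parity_of_lt (by simp only; omega))
      (parity_of_lt (by simp only; omega))
    have e : (-(((r.succ : Fin (k + 1)) : ℕ) + 1 : ℤ) + 1) = -((r : ℤ) + 1) := by
      rw [Fin.val_succ]
      push_cast
      ring
    simp only [e, Fin.val_castSucc]
    exact h
  · intro i
    have h := Matrix.ext_iff.mpr (Ring.mul_inverse_cancel _
      (isUnit_onePlus (leading A (k + 1) hle) c)) i (Fin.last k)
    rw [Matrix.mul_apply, Matrix.one_apply] at h
    rw [← h]
    refine Finset.sum_congr rfl fun j _ => ?_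
    rw [leading, onePlus_submatrix A (Fin.castLE_injective hle)]
    rfl

theorem evenDet_eq_prod (hA : IsGlMatrix A) (k : ℕ) (hk : k ≤ m) :
    evenDet A k hk = (List.ofFn fun i : Fin k =>
      Ring.inverse (corner A i (by omega) (-((i : ℤ) + 1) + 1))).prod := by
  induction k with
  | zero => simp [evenDet, orderedDet]
  | succ k ih =>
    rw [List.ofFn_succ', List.concat_eq_append, List.prod_append, List.prod_singleton]
    have h := evenDet_succ_mul_corner hA k hk
    have hu := Ring.mul_inverse_cancel _ (isUnit_corner A k (by omega) (-((k : ℤ) + 1) + 1))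
    rw [← mul_one (evenDet A (k + 1) hk), ← hu, ← mul_assoc, h, ih]
    rfl

/-- The shifted row determinant of the odd block formed by the last `r` rows and columns of the
inverse matrices, where `s + r = n`. -/
def oddDet (A : Matrix (Fin (m + n)) (Fin (m + n)) R) (s r : ℕ) (h : s + r = n) : R⟦X⟧ :=
  orderedDet (fun k i j : Fin r => Ring.inverse (onePlus A (-(m : ℤ) + (((s + k : ℕ) : ℤ) + 1)))
    ⟨m + (s + j), by omega⟩ ⟨m + (s + i), by omega⟩) id

theorem oddDet_succ (hA : IsGlMatrix A) (s r : ℕ) (h : s + (r + 1) = n) :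
    oddDet A s (r + 1) h = corner A (m + s) (by omega) (-(m : ℤ) + ((s : ℤ) + 1)) *
      oddDet A (s + 1) r (by omega) := by
  obtain ⟨ρ, hρ0, hρ1, hρ⟩ := exists_row A (m + s) (by omega) (-(m : ℤ) + ((s : ℤ) + 1))
  have key := first_mul_orderedDet (M := fun k i j : Fin (r + 1) =>
    Ring.inverse (onePlus A (-(m : ℤ) + (((s + k : ℕ) : ℤ) + 1)))
      ⟨m + (s + j), by omega⟩ ⟨m + (s + i), by omega⟩) ?_
    (x := fun j => ρ ⟨m + (s + j), by omega⟩)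
    (w := corner A (m + s) (by omega) (-(m : ℤ) + ((s : ℤ) + 1))) ?_
  · have e : ρ ⟨m + (s + (0 : Fin (r + 1))), by omega⟩ = 1 := hρ1
    rw [e, one_mul] at key
    rw [oddDet, key]
    congr 2
    funext k i j
    have e1 : ∀ i : Fin r, s + ((i.succ : Fin (r + 1)) : ℕ) = s + 1 + i := by
      intro i
      rw [Fin.val_succ]
      omega
    simp only [e1]
  · intro k i i' j j'
    have h := odd_exchange hA (-(m : ℤ) + (((s + k : ℕ) : ℤ) + 1))
      (i := ⟨m + (s + i), by omega⟩) (j := ⟨m + (s + j), by omega⟩)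
      (k := ⟨m + (s + i'), by omega⟩) (l := ⟨m + (s + j'), by omega⟩)
      (parity_of_le (by simp only; omega)) (parity_of_le (by simp only; omega))
      (parity_of_le (by simp only; omega))
    have e : (-(m : ℤ) + (((s + (k.succ : Fin (r + 1)) : ℕ) : ℤ) + 1)) =
        -(m : ℤ) + (((s + k : ℕ) : ℤ) + 1) + 1 := by
      rw [Fin.val_succ]
      push_cast
      ring
    simp only [e, Fin.val_castSucc]
    exact h
  · intro i
    have h1 := hρ ⟨m + (s + i), by omega⟩ (by simp only; omega)
    have e : ((⟨m + (s + i), by omega⟩ : Fin (m + n)) : ℕ) = m + s ↔ i = 0 := by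
      rw [Fin.ext_iff, Fin.val_zero]
      simp only
      omega
    simp only [e] at h1
    rw [← h1]
    -- only the indices from `m + s` on contribute to the sum over all indices
    refine Finset.sum_of_injOn (fun j : Fin (r + 1) => (⟨m + (s + j), by omega⟩ : Fin (m + n)))
      ?_ ?_ ?_ ?_
    · intro j _ j' _ hjj
      simp only [Fin.mk.injEq] at hjj
      exact Fin.ext (by omega)
    · intro j _
      exact Finset.mem_coe.mpr (Finset.mem_univ _)
    · intro j _ hj
      rw [hρ0 j, zero_mul]
      by_contra hlt
      exact hj ⟨⟨j - (m + s), by omega⟩, Finset.mem_coe.mpr (Finset.mem_univ _),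
        Fin.ext (by simp only; omega)⟩
    · intro j _
      simp only [Fin.val_zero, add_zero]

theorem oddDet_eq_prod (hA : IsGlMatrix A) (s r : ℕ) (h : s + r = n) :
    oddDet A s r h = (List.ofFn fun i : Fin r =>
      corner A (m + (s + i)) (by omega) (-(m : ℤ) + (((s + i : ℕ) : ℤ) + 1))).prod := by
  induction r generalizing s with
  | zero => simp [oddDet, orderedDet]
  | succ r ih =>
    rw [oddDet_succ hA, ih, List.ofFn_succ, List.prod_cons]
    congr 3
    funext i
    have e : s + ((i.succ : Fin (r + 1)) : ℕ) = s + 1 + i := by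
      rw [Fin.val_succ]
      omega
    simp only [e]
    exact corner_congr A (by omega) _ _ _

end Decomposition

/-! ### The quantum Berezinian -/

theorem evenFactor_eq (m n : ℕ) (k : Fin m) : evenFactor m n k =
    Ring.inverse (corner (Ehat m n) k (by omega) (-((k : ℤ) + 1) + 1)) := rfl

theorem oddFactor_eq (m n : ℕ) (j : Fin n) : oddFactor m n j =
    corner (Ehat m n) (m + j) (by omega) (-(m : ℤ) + ((j : ℤ) + 1)) :=
  Ring.inverse_inverse (isUnit_corner _ _ _ _)

theorem berezinian_eq (m n : ℕ) : berezinian m n =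
    (List.ofFn (evenFactor m n)).prod * (List.ofFn (oddFactor m n)).prod := by
  have h1 := evenDet_eq_prod (isGlMatrix_Ehat m n) m le_rfl
  have h2 := oddDet_eq_prod (isGlMatrix_Ehat m n) 0 n (zero_add n)
  have h3 : berezinian m n = evenDet (Ehat m n) m le_rfl * oddDet (Ehat m n) 0 n (zero_add n) := by
    simp only [oddDet, zero_add]
    rfl
  rw [h3, h1, h2]
  congr 3
  funext j
  rw [oddFactor_eq]
  simp only [zero_add]
  exact corner_congr _ (by omega) _ _ _

theorem commute_factors (m n : ℕ) (a b : Fin m ⊕ Fin n) :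
    Commute (Sum.elim (evenFactor m n) (oddFactor m n) a)
      (Sum.elim (evenFactor m n) (oddFactor m n) b) := by
  have hA := isGlMatrix_Ehat m n
  have hinv : ∀ {x y : (U m n)⟦X⟧}, IsUnit x → Commute x y → Commute (Ring.inverse x) y :=
    fun hx h => (commute_inverse hx h.symm).symm
  have hee : ∀ k l : Fin m, k < l → Commute (evenFactor m n k) (evenFactor m n l) := by
    intro k l hkl
    rw [evenFactor_eq, evenFactor_eq]
    exact hinv (isUnit_corner _ _ _ _) (commute_inverse (isUnit_corner _ _ _ _)
      (commute_corner hA hkl _ _ _ _))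
  have heo : ∀ (k : Fin m) (j : Fin n), Commute (evenFactor m n k) (oddFactor m n j) := by
    intro k j
    rw [evenFactor_eq, oddFactor_eq]
    exact hinv (isUnit_corner _ _ _ _) (commute_corner hA (by omega) _ _ _ _)
  have hoo : ∀ i j : Fin n, i < j → Commute (oddFactor m n i) (oddFactor m n j) := by
    intro i j hij
    rw [oddFactor_eq, oddFactor_eq]
    exact commute_corner hA (Nat.add_lt_add_left hij m) _ _ _ _
  rcases a with k | i <;> rcases b with l | j
  · rcases lt_trichotomy k l with h | rfl | h
    exacts [hee k l h, Commute.refl _, (hee l k h).symm]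
  · exact heo k j
  · exact (heo l i).symm
  · rcases lt_trichotomy i j with h | rfl | h
    exacts [hoo i j h, Commute.refl _, (hoo j i h).symm]

end Glmn

end

theorem theorem3p1 (m n : ℕ) :
    -- all inverses and quasideterminants involved exist
    (∀ j : Fin n, IsUnit (Glmn.oddMatrix m n j)) ∧
    (∀ k : Fin m, Glmn.HasQuasidet (Glmn.evenLeading m n k) (Fin.last _) (Fin.last _)) ∧
    (∀ j : Fin n, Glmn.HasQuasidet (Glmn.oddLeading m n j) (Fin.last _) (Fin.last _)) ∧
    -- the decomposition
    Glmn.berezinian m n =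
      (List.ofFn (Glmn.evenFactor m n)).prod * (List.ofFn (Glmn.oddFactor m n)).prod ∧
    -- the factors are pairwise permutable
    (∀ a b : Fin m ⊕ Fin n,
      Commute (Sum.elim (Glmn.evenFactor m n) (Glmn.oddFactor m n) a)
        (Sum.elim (Glmn.evenFactor m n) (Glmn.oddFactor m n) b)) :=
  ⟨fun _ => Glmn.isUnit_onePlus _ _, fun _ => Glmn.hasQuasidet_onePlus _ _ _,
    fun _ => Glmn.hasQuasidet_onePlus _ _ _, Glmn.berezinian_eq m n, Glmn.commute_factors m n⟩
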